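/- Let $(M_n)_{n\ge 0}$ be a sequence of positive real numbers with $M_0=1$ and $\frac{M_{n+m}}{M_nM_m}\ge\binom{n+m}{n}$ for all non-negative integers $m,n$, and suppose that $(M_n)$ is non-analytic, i.e. $\lim_{n\to\infty}(n!/M_n)^{1/n}=0$. Let $D([0,1],M)$ be the algebra of all infinitely differentiable functions $f:[0,1]\to\mathbb{C}$ (with one-sided derivatives at the endpoints) such that $\sum_{n=0}^{\infty}\|f^{(n)}\|_\infty/M_n<\infty$, where $\|\cdot\|_\infty$ is the supremum norm on $[0,1]$. Let $\phi:[0,1]\to[0,1]$ be any map that induces an endomorphism of $D([0,1],M)$, i.e. such that $f\circ\phi\in D([0,1],M)$ for every $f\in D([0,1],M)$. Then $\phi$ is infinitely differentiable on $[0,1]$ and $\|\phi'\|_\infty\le 1$. -/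

import Mathlib

open Set Filter Topology
open scoped ContDiff

/-- A weight sequence: positive numbers `M n` with `M 0 = 1` and
`M (n + m) / (M n * M m) ≥ (n + m).choose n` for all `n`, `m`. -/
structure IsWeight (M : ℕ → ℝ) : Prop where
  pos : ∀ n, 0 < M n
  zero : M 0 = 1
  choose_le : ∀ n m, ((n + m).choose n : ℝ) ≤ M (n + m) / (M n * M m)

/-- The sequence `M` is non-analytic: `(n! / M n) ^ (1 / n) → 0` as `n → ∞`. -/
def IsNonAnalytic (M : ℕ → ℝ) : Prop :=
  Tendsto (fun n : ℕ => ((n.factorial : ℝ) / M n) ^ (1 / (n : ℝ))) atTop (𝓝 0)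

/-- The uniform norm on `[0,1]`. It is only used for functions that are continuous on `[0,1]`,
so the supremum is that of a bounded set. -/
noncomputable def supNorm {E : Type*} [Norm E] (f : ℝ → E) : ℝ :=
  ⨆ x : Icc (0 : ℝ) 1, ‖f x‖

/-- Membership in `D([0,1], M)`, for a complex-valued function on `[0,1]` (given as a function on
`ℝ` of which only the values on `[0,1]` matter): `f` is `C^∞` on `[0,1]`, with one-sided
derivatives at the endpoints, and `∑ ‖f⁽ⁿ⁾‖_∞ / M n < ∞`. -/
def MemD (M : ℕ → ℝ) (f : ℝ → ℂ) : Prop :=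
  ContDiffOn ℝ ∞ f (Icc 0 1) ∧
    Summable fun n : ℕ => supNorm (iteratedDerivWithin n f (Icc 0 1)) / M n

/-- The map `φ` induces an endomorphism `f ↦ f ∘ φ` of the algebra `D([0,1], M)`:
`f ∘ φ ∈ D([0,1], M)` whenever `f ∈ D([0,1], M)`. -/
def InducesEndomorphism (M : ℕ → ℝ) (φ : ℝ → ℝ) : Prop :=
  ∀ f : ℝ → ℂ, MemD M f → MemD M (f ∘ φ)

/-!
The closed graph theorem bounds the `k`-th derivative of `e^{isφ}`, uniformly in `s ≥ 0`, by a
constant times `M k * ∑ j, s ^ j / M j`. Put `t = r * s` with `r > 1` and let `n` be a central index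
of `∑ t ^ k / M k`: up to constants the sum is then at most `μ = t ^ n / M n`, so the `n`-th
derivative is `O(t ^ n)`, while non-analyticity gives `n = o(t)` and `μ = O(e ^ t)`.

If `|φ'| ≥ a > r` on an interval, the first derivative of `e^{isφ}` has size at least `(a / r) * t`
there. For a Gaussian weight, an integration by parts shows that the `L²` norms of successive
derivatives are log-convex up to boundary terms, which the weight makes negligible, and up to
an error which is negligible over `n = o(t)` steps. So the `n`-th derivative has size at
least `(q * t) ^ n` for every `q < a / r`; as `q > 1` is possible, this is a contradiction.
-/

theorem IsWeight.mul_le {M : ℕ → ℝ} (hM : IsWeight M) (n m : ℕ) : M n * M m ≤ M (n + m) := by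
  have hchoose : (1 : ℝ) ≤ (n + m).choose n := by
    exact_mod_cast Nat.choose_pos (Nat.le_add_right n m)
  exact (one_le_div (mul_pos (hM.pos n) (hM.pos m))).1 (hchoose.trans (hM.choose_le n m))

section CentralIndex

variable {M : ℕ → ℝ}

/-- `n` is a central index, in the sense of Wiman–Valiron theory, of the power series
`∑ t ^ k / M k` at the point `t`: its `n`-th term is maximal. -/
def IsCentralIndex (M : ℕ → ℝ) (t : ℝ) (n : ℕ) : Prop :=
  ∀ k, t ^ k / M k ≤ t ^ n / M n

theorem IsCentralIndex.le_pow {t : ℝ} {n : ℕ} (hn : IsCentralIndex M t n) (hpos : ∀ n, 0 < M n)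
    (h0 : M 0 ≤ 1) : M n ≤ t ^ n := by
  have h : 1 ≤ t ^ n / M n := calc
    1 ≤ t ^ 0 / M 0 := by simpa using (one_le_inv₀ (hpos 0)).2 h0
    _ ≤ t ^ n / M n := hn 0
  exact (one_le_div (hpos n)).1 h

theorem IsCentralIndex.le_pow_mul {t : ℝ} {n : ℕ} (hn : IsCentralIndex M t n) (ht : 0 ≤ t)
    (hpos : ∀ n, 0 < M n) (hmul : ∀ n m, M n * M m ≤ M (n + m)) {k : ℕ} (hk : k ≤ n) :
    M k ≤ t ^ k * (t ^ n / M n) := by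
  have h0 : M 0 ≤ 1 := by nlinarith [hmul 0 0, hpos 0]
  obtain ⟨m, rfl⟩ := Nat.exists_eq_add_of_le hk
  refine le_of_mul_le_mul_right ?_ (hpos m)
  calc M k * M m ≤ t ^ (k + m) := (hmul k m).trans (hn.le_pow hpos h0)
    _ = t ^ k * t ^ m := pow_add t k m
    _ ≤ t ^ k * (t ^ (k + m) / M (k + m) * M m) := by
        gcongr
        exact (div_le_iff₀ (hpos m)).1 (hn m)
    _ = t ^ k * (t ^ (k + m) / M (k + m)) * M m := by ring

theorem eventually_lt_of_isCentralIndex (hpos : ∀ n, 0 < M n) (N : ℕ) :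
    ∀ᶠ t : ℝ in atTop, ∀ n, IsCentralIndex M t n → N < n := by
  have h : ∀ᶠ t : ℝ in atTop, ∀ n ∈ Finset.range (N + 1), M (N + 1) / M n < t :=
    (Finset.eventually_all _).2 fun n _ => eventually_gt_atTop _
  filter_upwards [h, eventually_ge_atTop 1] with t ht ht1 n hn
  by_contra! hnN
  have hlt : t ^ n / M n < t ^ (N + 1) / M (N + 1) := by
    rw [div_lt_div_iff₀ (hpos _) (hpos _)]
    calc t ^ n * M (N + 1) < t ^ n * (t * M n) := by
          gcongr
          exact (div_lt_iff₀ (hpos n)).1 (ht n (Finset.mem_range.2 (by omega)))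
      _ = t ^ (n + 1) * M n := by ring
      _ ≤ t ^ (N + 1) * M n := by
          gcongr
          exact (hpos n).le
  exact (hn (N + 1)).not_gt hlt

end CentralIndex

namespace IsNonAnalytic

variable {M : ℕ → ℝ}

theorem eventually_pow_mul_factorial_le (h : IsNonAnalytic M) (hpos : ∀ n, 0 < M n) {K : ℝ}
    (hK : 0 < K) : ∀ᶠ n : ℕ in atTop, K ^ n * n.factorial ≤ M n := by
  filter_upwards [h.eventually_lt_const (inv_pos.2 hK), eventually_gt_atTop 0] with n hn hn0
  have hnn : 0 ≤ (n.factorial : ℝ) / M n := div_nonneg (by positivity) (hpos n).le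
  have hpow : (n.factorial : ℝ) / M n ≤ (K ^ n)⁻¹ := by
    have := pow_le_pow_left₀ (Real.rpow_nonneg hnn _) hn.le n
    rwa [one_div, Real.rpow_inv_natCast_pow hnn hn0.ne', inv_pow] at this
  rwa [div_le_iff₀ (hpos n), le_inv_mul_iff₀ (by positivity)] at hpow

theorem exists_pow_div_le (h : IsNonAnalytic M) (hpos : ∀ n, 0 < M n) :
    ∃ C : ℝ, ∀ (n : ℕ) (t : ℝ), 0 ≤ t → t ^ n / M n ≤ C * (t ^ n / n.factorial) := by
  have hle : ∀ᶠ n : ℕ in atTop, (n.factorial : ℝ) / M n ≤ 1 := by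
    filter_upwards [h.eventually_pow_mul_factorial_le hpos one_pos] with n hn
    exact (div_le_one (hpos n)).2 (by simpa using hn)
  obtain ⟨C, hC⟩ := (isBoundedUnder_of_eventually_le hle).bddAbove_range
  refine ⟨C, fun n t ht => ?_⟩
  calc t ^ n / M n = n.factorial / M n * (t ^ n / n.factorial) := by
        have := (hpos n).ne'
        field_simp
    _ ≤ C * (t ^ n / n.factorial) :=
        mul_le_mul_of_nonneg_right (hC ⟨n, rfl⟩) (by positivity)

theorem exists_pow_div_le_exp (h : IsNonAnalytic M) (hpos : ∀ n, 0 < M n) :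
    ∃ C : ℝ, ∀ (n : ℕ) (t : ℝ), 0 ≤ t → t ^ n / M n ≤ C * Real.exp t := by
  obtain ⟨C, hC⟩ := h.exists_pow_div_le hpos
  refine ⟨C, fun n t ht => (hC n t ht).trans ?_⟩
  have hC0 : 0 ≤ C := (inv_pos.2 (hpos 0)).le.trans (by simpa using hC 0 0 le_rfl)
  exact mul_le_mul_of_nonneg_left (Real.pow_div_factorial_le_exp t ht n) hC0

theorem summable_pow_div (h : IsNonAnalytic M) (hpos : ∀ n, 0 < M n) {t : ℝ} (ht : 0 ≤ t) :
    Summable fun n => t ^ n / M n := by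
  obtain ⟨C, hC⟩ := h.exists_pow_div_le hpos
  exact .of_nonneg_of_le (fun n => div_nonneg (by positivity) (hpos n).le)
    (fun n => hC n t ht) ((Real.summable_pow_div_factorial t).mul_left C)

theorem exists_isCentralIndex (h : IsNonAnalytic M) (hpos : ∀ n, 0 < M n) {t : ℝ} (ht : 0 < t) :
    ∃ n, IsCentralIndex M t n := by
  have hterm : ∀ n, 0 < t ^ n / M n := fun n => div_pos (by positivity) (hpos n)
  have hinv : Tendsto (fun n => (t ^ n / M n)⁻¹) cofinite atTop := by
    rw [Nat.cofinite_eq_atTop]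
    exact (tendsto_nhdsWithin_iff.2 ⟨(h.summable_pow_div hpos ht.le).tendsto_atTop_zero,
      Eventually.of_forall hterm⟩).inv_tendsto_nhdsGT_zero
  obtain ⟨n, hn⟩ := hinv.exists_forall_le
  exact ⟨n, fun k => (inv_le_inv₀ (hterm n) (hterm k)).1 (hn k)⟩

theorem tsum_div_pow_le (h : IsNonAnalytic M) (hpos : ∀ n, 0 < M n) {r t : ℝ} (hr : 1 < r)
    (ht : 0 ≤ t) {n : ℕ} (hn : IsCentralIndex M t n) :
    ∑' k, (t / r) ^ k / M k ≤ (1 - r⁻¹)⁻¹ * (t ^ n / M n) := by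
  have hr0 : 0 ≤ r⁻¹ := by positivity
  have hr1 : r⁻¹ < 1 := inv_lt_one_of_one_lt₀ hr
  rw [← tsum_geometric_of_lt_one hr0 hr1, ← tsum_mul_right]
  refine Summable.tsum_le_tsum (fun k => ?_) (h.summable_pow_div hpos (by positivity))
    ((summable_geometric_of_lt_one hr0 hr1).mul_right _)
  calc (t / r) ^ k / M k = r⁻¹ ^ k * (t ^ k / M k) := by rw [div_pow, inv_pow]; ring
    _ ≤ r⁻¹ ^ k * (t ^ n / M n) := mul_le_mul_of_nonneg_left (hn k) (by positivity)

theorem eventually_isCentralIndex_le_mul (h : IsNonAnalytic M) (hpos : ∀ n, 0 < M n)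
    (h0 : M 0 ≤ 1) {ε : ℝ} (hε : 0 < ε) :
    ∀ᶠ t : ℝ in atTop, ∀ n : ℕ, IsCentralIndex M t n → (n : ℝ) ≤ ε * t := by
  obtain ⟨N, hN⟩ := eventually_atTop.1
    (h.eventually_pow_mul_factorial_le hpos (div_pos (Real.exp_pos 1) hε))
  filter_upwards [eventually_lt_of_isCentralIndex hpos N, eventually_gt_atTop 0] with t ht ht0 n hn
  have hNn : N < n := ht n hn
  have hexp : (n : ℝ) ^ n ≤ Real.exp n * n.factorial :=
    (div_le_iff₀ (by positivity)).1 (Real.pow_div_factorial_le_exp n (by positivity) n)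
  have hpow : ((n : ℝ) / ε) ^ n ≤ t ^ n := calc
    ((n : ℝ) / ε) ^ n = (n : ℝ) ^ n / ε ^ n := div_pow _ _ _
    _ ≤ Real.exp n * n.factorial / ε ^ n := by gcongr
    _ = (Real.exp 1 / ε) ^ n * n.factorial := by
        rw [div_pow, ← Real.exp_nat_mul, mul_one]; ring
    _ ≤ M n := hN n hNn.le
    _ ≤ t ^ n := hn.le_pow hpos h0
  exact (div_le_iff₀' hε).1 (le_of_pow_le_pow_left₀ (by omega) ht0.le hpow)

end IsNonAnalytic

section GaussianEnergy

variable {E : Type*} [NormedAddCommGroup E] {B c d : ℝ}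

/-- The squared `L²` norm of `v` on `[c - d, c + d]` with the Gaussian weight
`exp (-B (x - c)²)`. -/
noncomputable def gaussianEnergy (B c d : ℝ) (v : ℝ → E) : ℝ :=
  ∫ x in (c - d)..(c + d), Real.exp (-B * (x - c) ^ 2) * ‖v x‖ ^ 2

theorem continuousOn_gaussian_mul_norm_sq {v : ℝ → E} {s : Set ℝ} (hv : ContinuousOn v s) :
    ContinuousOn (fun x => Real.exp (-B * (x - c) ^ 2) * ‖v x‖ ^ 2) s := by
  fun_prop

theorem gaussianEnergy_nonneg (hd : 0 ≤ d) (v : ℝ → E) : 0 ≤ gaussianEnergy B c d v :=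
  intervalIntegral.integral_nonneg (by linarith) fun _ _ => by positivity

theorem mul_gaussianEnergy_le {F : Type*} [NormedAddCommGroup F] {R : ℝ} (hd : 0 ≤ d)
    {v : ℝ → E} {w : ℝ → F} (hv : ContinuousOn v (Icc (c - d) (c + d)))
    (hw : ContinuousOn w (Icc (c - d) (c + d)))
    (h : ∀ x ∈ Icc (c - d) (c + d), R * ‖v x‖ ^ 2 ≤ ‖w x‖ ^ 2) :
    R * gaussianEnergy B c d v ≤ gaussianEnergy B c d w := by
  have hle : c - d ≤ c + d := by linarith
  rw [gaussianEnergy, ← intervalIntegral.integral_const_mul]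
  refine intervalIntegral.integral_mono_on hle
    ((continuousOn_gaussian_mul_norm_sq hv).intervalIntegrable_of_Icc hle |>.const_mul R)
    ((continuousOn_gaussian_mul_norm_sq hw).intervalIntegrable_of_Icc hle) fun x hx => ?_
  rw [mul_left_comm]
  exact mul_le_mul_of_nonneg_left (h x hx) (Real.exp_pos _).le

theorem le_gaussianEnergy (hB : 0 ≤ B) (hd : 0 ≤ d) {v : ℝ → E}
    (hv : ContinuousOn v (Icc (c - d) (c + d))) (h : ∀ x ∈ Icc (c - d) (c + d), ‖v x‖ = 1) :
    d * Real.exp (-B * (d / 2) ^ 2) ≤ gaussianEnergy B c d v := by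
  have hle : c - d ≤ c + d := by linarith
  have hhalf : c - d / 2 ≤ c + d / 2 := by linarith
  have hsub : Icc (c - d / 2) (c + d / 2) ⊆ Icc (c - d) (c + d) :=
    Icc_subset_Icc (by linarith) (by linarith)
  have hcont := continuousOn_gaussian_mul_norm_sq (B := B) (c := c) hv
  calc d * Real.exp (-B * (d / 2) ^ 2)
      = ∫ x in (c - d / 2)..(c + d / 2), Real.exp (-B * (d / 2) ^ 2) := by
        rw [intervalIntegral.integral_const, smul_eq_mul]; ring
    _ ≤ ∫ x in (c - d / 2)..(c + d / 2), Real.exp (-B * (x - c) ^ 2) * ‖v x‖ ^ 2 := by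
        refine intervalIntegral.integral_mono_on hhalf intervalIntegrable_const
          ((hcont.mono hsub).intervalIntegrable_of_Icc hhalf) fun x hx => ?_
        rw [h x (hsub hx), one_pow, mul_one, Real.exp_le_exp, neg_mul, neg_mul, neg_le_neg_iff]
        refine mul_le_mul_of_nonneg_left (sq_le_sq' ?_ ?_) hB <;> linarith [hx.1, hx.2]
    _ ≤ gaussianEnergy B c d v :=
        intervalIntegral.integral_mono_interval (by linarith) hhalf (by linarith)
          (Eventually.of_forall fun x => by positivity) (hcont.intervalIntegrable_of_Icc hle)

variable [InnerProductSpace ℝ E]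

/-- The flux whose increment over `[c - d, c + d]` compares the Gaussian energies of `v₀`, of its
derivative `v₁` and of its second derivative, when `R` is the growth ratio from `v₀` to `v₁`. -/
noncomputable def energyFlux (B c R : ℝ) (v₀ v₁ : ℝ → E) (x : ℝ) : ℝ :=
  Real.exp (-B * (x - c) ^ 2) * (2 * B * (x - c) * ‖v₁ x‖ ^ 2 - 2 * R * inner ℝ (v₁ x) (v₀ x))

theorem hasDerivAt_energyFlux {v₀ v₁ : ℝ → E} {v₂ : E} (R : ℝ) {x : ℝ}
    (h₀ : HasDerivAt v₀ (v₁ x) x) (h₁ : HasDerivAt v₁ v₂ x) :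
    HasDerivAt (energyFlux B c R v₀ v₁)
      (Real.exp (-B * (x - c) ^ 2) *
        (R ^ 2 * ‖v₀ x‖ ^ 2 + (2 * B - 2 * R) * ‖v₁ x‖ ^ 2 + ‖v₂‖ ^ 2 -
          ‖R • v₀ x + (v₂ - (2 * B * (x - c)) • v₁ x)‖ ^ 2)) x := by
  have hlin : HasDerivAt (fun y => y - c) 1 x := (hasDerivAt_id' x).sub_const c
  refine (((hlin.pow 2).const_mul (-B)).exp.mul (((hlin.const_mul (2 * B)).mul h₁.norm_sq).sub
    ((h₁.inner ℝ h₀).const_mul (2 * R)))).congr_deriv ?_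
  rw [norm_add_sq_real, norm_sub_sq_real, inner_sub_right]
  simp only [norm_smul, real_inner_smul_left, real_inner_smul_right, mul_pow, Real.norm_eq_abs,
    sq_abs, real_inner_self_eq_norm_sq, Pi.pow_apply, Pi.mul_apply, Pi.sub_apply]
  rw [real_inner_comm (v₀ x) (v₁ x), real_inner_comm (v₀ x) v₂, real_inner_comm v₂ (v₁ x)]
  push_cast
  ring

theorem energyFlux_sub_le {v₀ v₁ v₂ : ℝ → E} (R : ℝ) (hd : 0 ≤ d)
    (h₀ : ∀ x ∈ Icc (c - d) (c + d), HasDerivAt v₀ (v₁ x) x)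
    (h₁ : ∀ x ∈ Icc (c - d) (c + d), HasDerivAt v₁ (v₂ x) x)
    (h₂ : ContinuousOn v₂ (Icc (c - d) (c + d))) :
    energyFlux B c R v₀ v₁ (c + d) - energyFlux B c R v₀ v₁ (c - d) ≤
      R ^ 2 * gaussianEnergy B c d v₀ + (2 * B - 2 * R) * gaussianEnergy B c d v₁ +
        gaussianEnergy B c d v₂ := by
  have hle : c - d ≤ c + d := by linarith
  have hflux := fun x hx => hasDerivAt_energyFlux (B := B) (c := c) R (h₀ x hx) (h₁ x hx)
  have hint : ∀ {v : ℝ → E}, ContinuousOn v (Icc (c - d) (c + d)) →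
      IntervalIntegrable (fun x => Real.exp (-B * (x - c) ^ 2) * ‖v x‖ ^ 2)
        MeasureTheory.volume (c - d) (c + d) :=
    fun hv => (continuousOn_gaussian_mul_norm_sq hv).intervalIntegrable_of_Icc hle
  have hint₀ := (hint (HasDerivAt.continuousOn h₀)).const_mul (R ^ 2)
  have hint₁ := (hint (HasDerivAt.continuousOn h₁)).const_mul (2 * B - 2 * R)
  simp only [gaussianEnergy]
  rw [← intervalIntegral.integral_const_mul, ← intervalIntegral.integral_const_mul,
    ← intervalIntegral.integral_add hint₀ hint₁,
    ← intervalIntegral.integral_add (hint₀.add hint₁) (hint h₂)]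
  refine intervalIntegral.sub_le_integral_of_hasDeriv_right_of_le hle
    (HasDerivAt.continuousOn hflux)
    (fun x hx => (hflux x (Ioo_subset_Icc_self hx)).hasDerivWithinAt)
    ((intervalIntegrable_iff_integrableOn_Icc_of_le hle).1
      ((hint₀.add hint₁).add (hint h₂))) fun x _ => ?_
  have hsq : 0 ≤ Real.exp (-B * (x - c) ^ 2) *
    ‖R • v₀ x + (v₂ x - (2 * B * (x - c)) • v₁ x)‖ ^ 2 := by positivity
  linarith

theorem neg_le_energyFlux_sub {v₀ v₁ : ℝ → E} {R P : ℝ} (hd : 0 ≤ d) (hB : 0 ≤ B) (hR : 0 ≤ R)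
    (hleft : ‖v₁ (c - d)‖ * ‖v₀ (c - d)‖ ≤ P) (hright : ‖v₁ (c + d)‖ * ‖v₀ (c + d)‖ ≤ P) :
    -(4 * R * (Real.exp (-B * d ^ 2) * P)) ≤
      energyFlux B c R v₀ v₁ (c + d) - energyFlux B c R v₀ v₁ (c - d) := by
  have hinner_right : inner ℝ (v₁ (c + d)) (v₀ (c + d)) ≤ P :=
    (real_inner_le_norm _ _).trans hright
  have hinner_left : -P ≤ inner ℝ (v₁ (c - d)) (v₀ (c - d)) :=
    neg_le_of_abs_le ((abs_real_inner_le_norm _ _).trans hleft)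
  have hsq : 0 ≤ 2 * B * d * (‖v₁ (c + d)‖ ^ 2 + ‖v₁ (c - d)‖ ^ 2) := by positivity
  have hsum : -(4 * R * P) ≤
      (2 * B * d * ‖v₁ (c + d)‖ ^ 2 - 2 * R * inner ℝ (v₁ (c + d)) (v₀ (c + d))) -
        (2 * B * -d * ‖v₁ (c - d)‖ ^ 2 - 2 * R * inner ℝ (v₁ (c - d)) (v₀ (c - d))) := by
    nlinarith
  have := mul_le_mul_of_nonneg_left hsum (Real.exp_pos (-B * d ^ 2)).le
  simp only [energyFlux, add_sub_cancel_left, sub_sub_cancel_left, neg_sq]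
  linarith

/-- The growth ratio of the energies of successive derivatives cannot drop by more than `2 * B`,
up to a boundary term: an approximate log-convexity. -/
theorem sub_mul_gaussianEnergy_le {v₀ v₁ v₂ : ℝ → E} {R P : ℝ} (hd : 0 ≤ d) (hB : 0 ≤ B)
    (hR : 0 ≤ R) (h₀ : ∀ x ∈ Icc (c - d) (c + d), HasDerivAt v₀ (v₁ x) x)
    (h₁ : ∀ x ∈ Icc (c - d) (c + d), HasDerivAt v₁ (v₂ x) x)
    (h₂ : ContinuousOn v₂ (Icc (c - d) (c + d)))
    (hleft : ‖v₁ (c - d)‖ * ‖v₀ (c - d)‖ ≤ P) (hright : ‖v₁ (c + d)‖ * ‖v₀ (c + d)‖ ≤ P)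
    (h : R * gaussianEnergy B c d v₀ ≤ gaussianEnergy B c d v₁) :
    (R - 2 * B) * gaussianEnergy B c d v₁ - 4 * R * (Real.exp (-B * d ^ 2) * P) ≤
      gaussianEnergy B c d v₂ := by
  linarith [energyFlux_sub_le (B := B) R hd h₀ h₁ h₂,
    neg_le_energyFlux_sub hd hB hR hleft hright, mul_le_mul_of_nonneg_left h hR]

theorem pow_mul_le_of_forall_ratio_sub_le {e : ℕ → ℝ} {R ρ : ℝ} (he : ∀ k, 0 ≤ e k) (hB : 0 ≤ B)
    (hρ : 0 ≤ ρ) {n : ℕ} (hR : ρ + 4 * B * n ≤ R) (h₁ : R * e 0 ≤ e 1)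
    (hstep : ∀ k, k + 1 < n → ∀ r ≤ R, 0 ≤ r → r * e k ≤ e (k + 1) →
      (r - 2 * B) * e (k + 1) - 2 * B * (ρ ^ (k + 1) * e 0) ≤ e (k + 2)) :
    ρ ^ n * e 0 ≤ e n := by
  have hratio : ∀ k ≤ n, ρ ≤ R - 4 * B * k := fun k hk => by
    have : 4 * B * k ≤ 4 * B * n := by gcongr
    linarith
  have hboth : ∀ k < n, (R - 4 * B * k) * e k ≤ e (k + 1) ∧ ρ ^ (k + 1) * e 0 ≤ e (k + 1) := by
    intro k
    induction k with
    | zero =>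
      intro hn
      have hρR : ρ ≤ R := by simpa using hratio 0 hn.le
      simpa using ⟨h₁, (mul_le_mul_of_nonneg_right hρR (he 0)).trans h₁⟩
    | succ k ih =>
      intro hk
      obtain ⟨ih_ratio, ih_pow⟩ := ih (by omega)
      have hloss : 2 * B * (ρ ^ (k + 1) * e 0) ≤ 2 * B * e (k + 1) := by gcongr
      have hnext : (R - 4 * B * (k + 1 : ℕ)) * e (k + 1) ≤ e (k + 2) := by
        have := hstep k hk _ (sub_le_self R (by positivity))
          (hρ.trans (hratio k (by omega))) ih_ratio
        push_cast
        linarith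
      refine ⟨hnext, ?_⟩
      calc ρ ^ (k + 2) * e 0 = ρ * (ρ ^ (k + 1) * e 0) := by ring
        _ ≤ ρ * e (k + 1) := by gcongr
        _ ≤ (R - 4 * B * (k + 1 : ℕ)) * e (k + 1) :=
            mul_le_mul_of_nonneg_right (hratio (k + 1) hk.le) (he _)
        _ ≤ e (k + 2) := hnext
  cases n with
  | zero => simp
  | succ n => exact (hboth n n.lt_succ_self).2

theorem pow_mul_gaussianEnergy_le {v : ℕ → ℝ → E} {R P ρ : ℝ} (hB : 0 ≤ B) (hd : 0 ≤ d)
    (hρ : 0 ≤ ρ) {n : ℕ} (hR : ρ + 4 * B * n ≤ R)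
    (hv : ∀ k, ∀ x ∈ Icc (c - d) (c + d), HasDerivAt (v k) (v (k + 1) x) x)
    (h₁ : R * gaussianEnergy B c d (v 0) ≤ gaussianEnergy B c d (v 1))
    (hleft : ∀ k < n, ‖v (k + 1) (c - d)‖ * ‖v k (c - d)‖ ≤ P * ρ ^ (k + 1))
    (hright : ∀ k < n, ‖v (k + 1) (c + d)‖ * ‖v k (c + d)‖ ≤ P * ρ ^ (k + 1))
    (hP : 0 ≤ P)
    (hRP : 2 * R * (Real.exp (-B * d ^ 2) * P) ≤ B * gaussianEnergy B c d (v 0)) :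
    ρ ^ n * gaussianEnergy B c d (v 0) ≤ gaussianEnergy B c d (v n) := by
  refine pow_mul_le_of_forall_ratio_sub_le (e := fun k => gaussianEnergy B c d (v k))
    (fun k => gaussianEnergy_nonneg hd _) hB hρ hR h₁ fun k hk r hrR hr hratio => ?_
  refine le_trans ?_ (sub_mul_gaussianEnergy_le hd hB hr (hv k) (hv (k + 1))
    (HasDerivAt.continuousOn (hv (k + 2))) (hleft k (by omega)) (hright k (by omega)) hratio)
  refine sub_le_sub_left ?_ _
  calc 4 * r * (Real.exp (-B * d ^ 2) * (P * ρ ^ (k + 1)))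
      ≤ 4 * R * (Real.exp (-B * d ^ 2) * (P * ρ ^ (k + 1))) := by gcongr
    _ = 2 * ρ ^ (k + 1) * (2 * R * (Real.exp (-B * d ^ 2) * P)) := by ring
    _ ≤ 2 * ρ ^ (k + 1) * (B * gaussianEnergy B c d (v 0)) := by gcongr
    _ = 2 * B * (ρ ^ (k + 1) * gaussianEnergy B c d (v 0)) := by ring

theorem pow_le_sq_of_norm_derivs_le {v : ℕ → ℝ → E} {R P Q ρ : ℝ} (hB : 0 ≤ B) (hd : 0 < d)
    (hρ : 0 ≤ ρ) {n : ℕ} (hR : ρ + 4 * B * n ≤ R)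
    (hv : ∀ k, ∀ x ∈ Icc (c - d) (c + d), HasDerivAt (v k) (v (k + 1) x) x)
    (h₀ : ∀ x ∈ Icc (c - d) (c + d), ‖v 0 x‖ = 1)
    (h₁ : ∀ x ∈ Icc (c - d) (c + d), R ≤ ‖v 1 x‖ ^ 2)
    (hn : ∀ x ∈ Icc (c - d) (c + d), ‖v n x‖ ≤ Q)
    (hprod : ∀ k < n, ∀ x ∈ Icc (c - d) (c + d), ‖v (k + 1) x‖ * ‖v k x‖ ≤ P * ρ ^ (k + 1))
    (hP : 0 ≤ P) (hRP : 2 * R * P ≤ B * d * Real.exp (3 / 4 * (B * d ^ 2))) :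
    ρ ^ n ≤ Q ^ 2 := by
  have hcont : ∀ k, ContinuousOn (v k) (Icc (c - d) (c + d)) := fun k =>
    HasDerivAt.continuousOn (hv k)
  have hmem_left : c - d ∈ Icc (c - d) (c + d) := ⟨le_rfl, by linarith⟩
  have hmem_right : c + d ∈ Icc (c - d) (c + d) := ⟨by linarith, le_rfl⟩
  have he₀ := le_gaussianEnergy hB hd.le (hcont 0) h₀
  have hlower : ρ ^ n * gaussianEnergy B c d (v 0) ≤ gaussianEnergy B c d (v n) := by
    refine pow_mul_gaussianEnergy_le hB hd.le hρ hR hv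
      (mul_gaussianEnergy_le hd.le (hcont 0) (hcont 1) fun x hx => ?_)
      (fun k hk => hprod k hk _ hmem_left) (fun k hk => hprod k hk _ hmem_right) hP ?_
    · simpa [h₀ x hx] using h₁ x hx
    · calc 2 * R * (Real.exp (-B * d ^ 2) * P) = 2 * R * P * Real.exp (-B * d ^ 2) := by ring
        _ ≤ B * d * Real.exp (3 / 4 * (B * d ^ 2)) * Real.exp (-B * d ^ 2) := by gcongr
        _ = B * (d * Real.exp (-B * (d / 2) ^ 2)) := by
            rw [mul_assoc, ← Real.exp_add, mul_assoc]
            ring_nf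
        _ ≤ B * gaussianEnergy B c d (v 0) := by gcongr
  have hupper : gaussianEnergy B c d (v n) ≤ Q ^ 2 * gaussianEnergy B c d (v 0) := by
    have := mul_gaussianEnergy_le (B := B) (R := 1) (w := fun x => Q • v 0 x) hd.le (hcont n)
      ((hcont 0).const_smul Q) fun x hx => by
        simpa [norm_smul, h₀ x hx] using pow_le_pow_left₀ (norm_nonneg _) (hn x hx) 2
    simpa [gaussianEnergy, norm_smul, mul_pow, mul_left_comm] using this
  exact le_of_mul_le_mul_right (hlower.trans hupper) (he₀.trans_lt' (by positivity))

end GaussianEnergy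

section IteratedDerivWithin

variable {𝕜 F : Type*} [NontriviallyNormedField 𝕜] [NormedAddCommGroup F] [NormedSpace 𝕜 F]
  {s : Set 𝕜}

theorem iteratedDerivWithin_eqOn_of_hasDerivWithinAt (hs : UniqueDiffOn 𝕜 s) {w : ℕ → 𝕜 → F}
    (hw : ∀ n, ∀ x ∈ s, HasDerivWithinAt (w n) (w (n + 1) x) s x) (n : ℕ) :
    EqOn (iteratedDerivWithin n (w 0) s) (w n) s := by
  induction n with
  | zero => intro x _; rw [iteratedDerivWithin_zero]
  | succ n ih =>
    intro x hx
    rw [iteratedDerivWithin_succ, derivWithin_congr ih (ih hx)]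
    exact (hw n x hx).derivWithin (hs x hx)

theorem contDiffOn_of_hasDerivWithinAt (hs : UniqueDiffOn 𝕜 s) {w : ℕ → 𝕜 → F}
    (hw : ∀ n, ∀ x ∈ s, HasDerivWithinAt (w n) (w (n + 1) x) s x) : ContDiffOn 𝕜 ∞ (w 0) s :=
  contDiffOn_of_differentiableOn_deriv fun m _ => DifferentiableOn.congr
    (fun x hx => (hw m x hx).differentiableWithinAt)
    (iteratedDerivWithin_eqOn_of_hasDerivWithinAt hs hw m)

theorem hasDerivWithinAt_iteratedDerivWithin (hs : UniqueDiffOn 𝕜 s) {f : 𝕜 → F}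
    (hf : ContDiffOn 𝕜 ∞ f s) (n : ℕ) {x : 𝕜} (hx : x ∈ s) :
    HasDerivWithinAt (iteratedDerivWithin n f s) (iteratedDerivWithin (n + 1) f s x) s x := by
  rw [iteratedDerivWithin_succ]
  exact (hf.differentiableOn_iteratedDerivWithin (by exact_mod_cast ENat.natCast_lt_top n) hs x
    hx).hasDerivWithinAt

end IteratedDerivWithin

theorem forall_hasDerivWithinAt_iff_eq_add_integral {E : Type*} [NormedAddCommGroup E]
    [NormedSpace ℝ E] [CompleteSpace E] {f f' : ℝ → E} {a b : ℝ} (hf' : Continuous f') :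
    (∀ x ∈ Icc a b, HasDerivWithinAt f (f' x) (Icc a b) x) ↔
      ∀ x ∈ Icc a b, f x = f a + ∫ t in a..x, f' t := by
  refine ⟨fun h x hx => ?_, fun h x hx => ?_⟩
  · have hsub : Icc a x ⊆ Icc a b := Icc_subset_Icc_right hx.2
    rw [intervalIntegral.integral_eq_sub_of_hasDerivAt_of_le hx.1
      ((HasDerivWithinAt.continuousOn h).mono hsub)
      (fun y hy => (h y (hsub (Ioo_subset_Icc_self hy))).hasDerivAt
        (Icc_mem_nhds hy.1 (hy.2.trans_le hx.2))) (hf'.intervalIntegrable _ _)]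
    abel
  · exact ((hf'.integral_hasStrictDerivAt a x).hasDerivAt.const_add (f a)).hasDerivWithinAt.congr
      h (h x hx)

theorem supNorm_congr {E : Type*} [Norm E] {f g : ℝ → E} (h : EqOn f g (Icc 0 1)) :
    supNorm f = supNorm g :=
  iSup_congr fun x => by rw [h x.2]

theorem supNorm_eq_norm {E : Type*} [NormedAddCommGroup E] {f : ℝ → E} {g : C(Icc (0 : ℝ) 1, E)}
    (h : ∀ x : Icc (0 : ℝ) 1, f x = g x) : supNorm f = ‖g‖ := by
  rw [ContinuousMap.norm_eq_iSup_norm]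
  exact iSup_congr fun x => by rw [h]

theorem MemD.of_hasDerivWithinAt {M : ℕ → ℝ} {w : ℕ → ℝ → ℂ}
    (hw : ∀ n, ∀ x ∈ Icc (0 : ℝ) 1, HasDerivWithinAt (w n) (w (n + 1) x) (Icc 0 1) x)
    (hs : Summable fun n => supNorm (w n) / M n) : MemD M (w 0) := by
  refine ⟨contDiffOn_of_hasDerivWithinAt uniqueDiffOn_Icc_zero_one hw, hs.congr fun n => ?_⟩
  rw [supNorm_congr (iteratedDerivWithin_eqOn_of_hasDerivWithinAt uniqueDiffOn_Icc_zero_one hw n)]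

/-- Sequences of continuous functions on `[0,1]`, with the `ℓ¹` norm. -/
abbrev ContSeq : Type := lp (fun _ : ℕ => C(Icc (0 : ℝ) 1, ℂ)) 1

namespace ContSeq

variable {M : ℕ → ℝ}

/-- The `n`-th term of a sequence, multiplied by the weight `M n` and extended to `ℝ` by constants
on each side of `[0,1]`. -/
noncomputable def term (M : ℕ → ℝ) (n : ℕ) (g : ContSeq) (x : ℝ) : ℂ :=
  M n * g n (projIcc 0 1 zero_le_one x)

theorem continuous_uncurry_term (M : ℕ → ℝ) (n : ℕ) : Continuous (Function.uncurry (term M n)) :=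
  continuous_const.mul (((lp.evalCLM ℂ _ 1 n).continuous.comp continuous_fst).eval
    (continuous_projIcc.comp continuous_snd))

theorem continuous_term (M : ℕ → ℝ) (n : ℕ) (g : ContSeq) : Continuous (term M n g) :=
  (continuous_uncurry_term M n).comp (Continuous.prodMk_right g)

theorem continuous_term_apply (M : ℕ → ℝ) (n : ℕ) (x : ℝ) : Continuous fun g => term M n g x :=
  (continuous_uncurry_term M n).comp (Continuous.prodMk_left x)

theorem term_add (n : ℕ) (g h : ContSeq) : term M n (g + h) = term M n g + term M n h := by
  ext x
  simp [term, mul_add]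

theorem term_smul (n : ℕ) (a : ℂ) (g : ContSeq) : term M n (a • g) = a • term M n g := by
  ext x
  simp [term, mul_left_comm]

theorem norm_term_le (hpos : ∀ n, 0 < M n) (n : ℕ) (g : ContSeq) (x : ℝ) :
    ‖term M n g x‖ ≤ M n * ‖g‖ := by
  rw [term, norm_mul, Complex.norm_real, Real.norm_of_nonneg (hpos n).le]
  exact mul_le_mul_of_nonneg_left ((ContinuousMap.norm_coe_le_norm _ _).trans
    (lp.norm_apply_le_norm one_ne_zero g n)) (hpos n).le

theorem supNorm_term_div (hpos : ∀ n, 0 < M n) (n : ℕ) (g : ContSeq) :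
    supNorm (term M n g) / M n = ‖g n‖ := by
  rw [supNorm_eq_norm (g := (M n : ℂ) • g n) (fun x => by simp [term]), norm_smul,
    Complex.norm_real, Real.norm_of_nonneg (hpos n).le, mul_div_cancel_left₀ _ (hpos n).ne']

theorem hasSum_supNorm_term_div (hpos : ∀ n, 0 < M n) (g : ContSeq) :
    HasSum (fun n => supNorm (term M n g) / M n) ‖g‖ := by
  simpa [supNorm_term_div hpos] using lp.hasSum_norm (p := 1) (by simp) g

theorem ext_of_eqOn_term (hpos : ∀ n, 0 < M n) {g h : ContSeq}
    (H : ∀ n, EqOn (term M n g) (term M n h) (Icc 0 1)) : g = h := by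
  refine Subtype.ext (funext fun n => ContinuousMap.ext fun x => ?_)
  exact mul_left_cancel₀ (Complex.ofReal_ne_zero.2 (hpos n).ne')
    (by simpa only [term, projIcc_val] using H n x.2)

theorem exists_term_eqOn (hpos : ∀ n, 0 < M n) {w : ℕ → ℝ → ℂ}
    (hw : ∀ n, ContinuousOn (w n) (Icc 0 1)) (hs : Summable fun n => supNorm (w n) / M n) :
    ∃ g : ContSeq, ∀ n, EqOn (term M n g) (w n) (Icc 0 1) := by
  let g : ℕ → C(Icc (0 : ℝ) 1, ℂ) := fun n => (M n : ℂ)⁻¹ • ⟨_, (hw n).domRestrict⟩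
  have hg : ∀ n, ‖g n‖ = supNorm (w n) / M n := fun n => by
    rw [norm_smul, norm_inv, Complex.norm_real, Real.norm_of_nonneg (hpos n).le,
      ← supNorm_eq_norm (f := w n) fun x => rfl, inv_mul_eq_div]
  refine ⟨⟨g, (memℓp_gen_iff (by simp)).2 (by simpa [hg] using hs)⟩, fun n x hx => ?_⟩
  have hM : (M n : ℂ) ≠ 0 := Complex.ofReal_ne_zero.2 (hpos n).ne'
  simp [term, g, projIcc_of_mem _ hx, mul_inv_cancel_left₀ hM]

end ContSeq

open ContSeq

/-- The sequences `(f⁽ⁿ⁾ / M n)` with `f` in `D([0,1], M)`: a model of `D([0,1], M)` as a closed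
subspace of a Banach space. The relation between consecutive terms is expressed by integrals
because these depend continuously on the sequence. -/
noncomputable def jetSpace (M : ℕ → ℝ) : Submodule ℂ ContSeq where
  carrier := {g | ∀ n, ∀ x ∈ Icc (0 : ℝ) 1,
    term M n g x = term M n g 0 + ∫ t in (0)..x, term M (n + 1) g t}
  zero_mem' n x _ := by simp [term]
  add_mem' {g h} hg hh n x hx := by
    simp only [term_add, Pi.add_apply]
    rw [intervalIntegral.integral_add ((continuous_term M _ g).intervalIntegrable _ _)
      ((continuous_term M _ h).intervalIntegrable _ _), hg n x hx, hh n x hx]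
    abel
  smul_mem' a g hg n x hx := by
    simp only [term_smul, Pi.smul_apply]
    rw [intervalIntegral.integral_smul, hg n x hx, smul_add]

namespace jetSpace

variable {M : ℕ → ℝ}

theorem mem_iff {g : ContSeq} : g ∈ jetSpace M ↔
    ∀ n, ∀ x ∈ Icc (0 : ℝ) 1, HasDerivWithinAt (term M n g) (term M (n + 1) g x) (Icc 0 1) x :=
  forall_congr' fun n =>
    (forall_hasDerivWithinAt_iff_eq_add_integral (continuous_term M (n + 1) g)).symm

theorem isClosed (M : ℕ → ℝ) : IsClosed (jetSpace M : Set ContSeq) := by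
  have hinter : (jetSpace M : Set ContSeq) = ⋂ (n : ℕ), ⋂ x ∈ Icc (0 : ℝ) 1,
      {g | term M n g x = term M n g 0 + ∫ t in (0)..x, term M (n + 1) g t} := by
    ext g
    simp only [mem_iInter]
    rfl
  rw [hinter]
  exact isClosed_iInter fun n => isClosed_biInter fun x _ => isClosed_eq
    (continuous_term_apply M n x) ((continuous_term_apply M n 0).add
      (intervalIntegral.continuous_parametric_intervalIntegral_of_continuous'
        (continuous_uncurry_term M (n + 1)) 0 x))

instance instCompleteSpace (M : ℕ → ℝ) : CompleteSpace (jetSpace M) :=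
  (isClosed M).completeSpace_coe

theorem iteratedDerivWithin_eqOn_term (g : jetSpace M) (n : ℕ) :
    EqOn (iteratedDerivWithin n (term M 0 (g : ContSeq)) (Icc 0 1)) (term M n (g : ContSeq))
      (Icc 0 1) :=
  iteratedDerivWithin_eqOn_of_hasDerivWithinAt uniqueDiffOn_Icc_zero_one
    (w := fun n => term M n (g : ContSeq)) (mem_iff.1 g.2) n

theorem ext_of_eqOn_term_zero (hpos : ∀ n, 0 < M n) {g h : jetSpace M}
    (H : EqOn (term M 0 (g : ContSeq)) (term M 0 (h : ContSeq)) (Icc 0 1)) : g = h :=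
  Subtype.ext <| ext_of_eqOn_term hpos fun n =>
    (iteratedDerivWithin_eqOn_term g n).symm.trans
      ((iteratedDerivWithin_congr H).trans (iteratedDerivWithin_eqOn_term h n))

theorem memD_term_zero (hpos : ∀ n, 0 < M n) (g : jetSpace M) :
    MemD M (term M 0 (g : ContSeq)) :=
  .of_hasDerivWithinAt (w := fun n => term M n (g : ContSeq)) (mem_iff.1 g.2)
    (hasSum_supNorm_term_div hpos _).summable

theorem exists_of_memD (hpos : ∀ n, 0 < M n) {f : ℝ → ℂ} (hf : MemD M f) :
    ∃ g : jetSpace M, EqOn (term M 0 (g : ContSeq)) f (Icc 0 1) := by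
  have hderiv := fun n x hx =>
    hasDerivWithinAt_iteratedDerivWithin uniqueDiffOn_Icc_zero_one hf.1 n (x := x) hx
  obtain ⟨g, hg⟩ := exists_term_eqOn hpos (fun n => HasDerivWithinAt.continuousOn (hderiv n)) hf.2
  refine ⟨⟨g, mem_iff.2 fun n x hx => ?_⟩, by simpa using hg 0⟩
  rw [hg (n + 1) hx]
  exact (hderiv n x hx).congr (hg n) (hg n hx)

theorem norm_eq_tsum (hpos : ∀ n, 0 < M n) (g : jetSpace M) {f : ℝ → ℂ}
    (h : EqOn (term M 0 (g : ContSeq)) f (Icc 0 1)) :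
    ‖g‖ = ∑' n, supNorm (iteratedDerivWithin n f (Icc 0 1)) / M n := by
  rw [Submodule.coe_norm, ← (hasSum_supNorm_term_div hpos _).tsum_eq]
  refine tsum_congr fun n => congrArg (· / M n) (supNorm_congr ?_)
  exact (iteratedDerivWithin_eqOn_term g n).symm.trans (iteratedDerivWithin_congr h)

theorem norm_iteratedDerivWithin_le (hpos : ∀ n, 0 < M n) (g : jetSpace M) {f : ℝ → ℂ}
    (h : EqOn (term M 0 (g : ContSeq)) f (Icc 0 1)) (n : ℕ) {x : ℝ} (hx : x ∈ Icc (0 : ℝ) 1) :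
    ‖iteratedDerivWithin n f (Icc 0 1) x‖ ≤ M n * ‖g‖ := by
  rw [← iteratedDerivWithin_congr h hx, iteratedDerivWithin_eqOn_term g n hx]
  exact norm_term_le hpos n _ x

end jetSpace

namespace InducesEndomorphism

variable {M : ℕ → ℝ} {φ : ℝ → ℝ}

theorem exists_linearMap (hpos : ∀ n, 0 < M n) (h : InducesEndomorphism M φ) :
    ∃ L : jetSpace M →ₗ[ℂ] jetSpace M, ∀ g : jetSpace M,
      EqOn (term M 0 (L g : ContSeq)) (term M 0 (g : ContSeq) ∘ φ) (Icc 0 1) := by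
  choose T hT using fun g : jetSpace M =>
    jetSpace.exists_of_memD hpos (h _ (jetSpace.memD_term_zero hpos g))
  refine ⟨⟨⟨T, fun g g' => ?_⟩, fun a g => ?_⟩, hT⟩ <;>
    refine jetSpace.ext_of_eqOn_term_zero hpos fun x hx => ?_
  · simp [hT _ hx, term_add]
  · simp [hT _ hx, term_smul]

theorem exists_continuousLinearMap (hpos : ∀ n, 0 < M n) (h : InducesEndomorphism M φ) :
    ∃ L : jetSpace M →L[ℂ] jetSpace M, ∀ g : jetSpace M,
      EqOn (term M 0 (L g : ContSeq)) (term M 0 (g : ContSeq) ∘ φ) (Icc 0 1) := by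
  obtain ⟨L, hL⟩ := h.exists_linearMap hpos
  have heval : ∀ x, Continuous fun g : jetSpace M => term M 0 (g : ContSeq) x := fun x =>
    (continuous_term_apply M 0 x).comp continuous_subtype_val
  refine ⟨⟨L, L.continuous_of_seq_closed_graph fun u g y hu hLu => ?_⟩, hL⟩
  refine jetSpace.ext_of_eqOn_term_zero hpos fun x hx => ?_
  refine tendsto_nhds_unique (((heval x).tendsto y).comp hLu) ?_
  rw [hL g hx]
  exact (((heval (φ x)).tendsto g).comp hu).congr fun n => (hL (u n) hx).symm

theorem exists_bound (hpos : ∀ n, 0 < M n) (hφ : MapsTo φ (Icc 0 1) (Icc 0 1))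
    (h : InducesEndomorphism M φ) :
    ∃ C : ℝ, 0 < C ∧ ∀ f, MemD M f → ∀ n, ∀ x ∈ Icc (0 : ℝ) 1,
      ‖iteratedDerivWithin n (f ∘ φ) (Icc 0 1) x‖ ≤
        C * M n * ∑' k, supNorm (iteratedDerivWithin k f (Icc 0 1)) / M k := by
  obtain ⟨L, hL⟩ := h.exists_continuousLinearMap hpos
  obtain ⟨C, hC0, hC⟩ := L.bound
  refine ⟨C, hC0, fun f hf n x hx => ?_⟩
  obtain ⟨g, hg⟩ := jetSpace.exists_of_memD hpos hf
  have hLg : EqOn (term M 0 (L g : ContSeq)) (f ∘ φ) (Icc 0 1) := fun y hy =>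
    (hL g hy).trans (hg (hφ hy))
  calc ‖iteratedDerivWithin n (f ∘ φ) (Icc 0 1) x‖ ≤ M n * ‖L g‖ :=
        jetSpace.norm_iteratedDerivWithin_le hpos (L g) hLg n hx
    _ ≤ M n * (C * ‖g‖) := mul_le_mul_of_nonneg_left (hC g) (hpos n).le
    _ = C * M n * ∑' k, supNorm (iteratedDerivWithin k f (Icc 0 1)) / M k := by
        rw [jetSpace.norm_eq_tsum hpos g hg]; ring

end InducesEndomorphism

theorem memD_ofReal (M : ℕ → ℝ) : MemD M fun x => (x : ℂ) := by
  let w : ℕ → ℝ → ℂ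
    | 0 => fun x => x
    | 1 => fun _ => 1
    | _ + 2 => fun _ => 0
  refine MemD.of_hasDerivWithinAt (w := w) (fun n x _ => ?_) ?_
  · match n with
    | 0 => exact Complex.ofRealCLM.hasDerivAt.hasDerivWithinAt
    | 1 => exact hasDerivWithinAt_const _ _ _
    | _ + 2 => exact hasDerivWithinAt_const _ _ _
  · refine summable_of_ne_finset_zero (s := Finset.range 2) fun n hn => ?_
    match n with
    | 0 | 1 => simp at hn
    | _ + 2 => simp [w, supNorm]

theorem InducesEndomorphism.contDiffOn {M : ℕ → ℝ} {φ : ℝ → ℝ} (h : InducesEndomorphism M φ) :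
    ContDiffOn ℝ ∞ φ (Icc 0 1) :=
  Complex.reCLM.contDiff.comp_contDiffOn (h _ (memD_ofReal M)).1

/-- The oscillation `e^{isφ}`, that is, the image of the character `e^{isx}` under composition with
`φ`. -/
noncomputable def wave (φ : ℝ → ℝ) (s x : ℝ) : ℂ :=
  Complex.exp (↑(s * φ x) * Complex.I)

section Wave

variable {φ : ℝ → ℝ} {s : ℝ}

theorem norm_wave (φ : ℝ → ℝ) (s x : ℝ) : ‖wave φ s x‖ = 1 :=
  Complex.norm_exp_ofReal_mul_I _

theorem wave_id_comp (φ : ℝ → ℝ) (s : ℝ) : wave id s ∘ φ = wave φ s :=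
  rfl

theorem hasDerivWithinAt_wave {φ' x : ℝ} {S : Set ℝ} (h : HasDerivWithinAt φ φ' S x) :
    HasDerivWithinAt (wave φ s) (wave φ s x * (↑(s * φ') * Complex.I)) S x :=
  ((h.const_mul s).ofReal_comp.mul_const Complex.I).cexp

theorem norm_derivWithin_wave {x : ℝ} {S : Set ℝ} (h : DifferentiableWithinAt ℝ φ S x)
    (hS : UniqueDiffWithinAt ℝ S x) :
    ‖derivWithin (wave φ s) S x‖ = |s| * |derivWithin φ S x| := by
  rw [(hasDerivWithinAt_wave h.hasDerivWithinAt).derivWithin hS]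
  simp [norm_wave]

theorem contDiffOn_wave {S : Set ℝ} (h : ContDiffOn ℝ ∞ φ S) : ContDiffOn ℝ ∞ (wave φ s) S :=
  ((Complex.ofRealCLM.contDiff.comp_contDiffOn (contDiffOn_const.mul h)).mul contDiffOn_const).cexp

theorem hasDerivWithinAt_pow_mul_wave_id (n : ℕ) {x : ℝ} {S : Set ℝ} :
    HasDerivWithinAt (fun y => (s * Complex.I) ^ n * wave id s y)
      ((s * Complex.I) ^ (n + 1) * wave id s x) S x := by
  refine ((hasDerivWithinAt_wave (hasDerivWithinAt_id x S)).const_mul _).congr_deriv ?_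
  push_cast
  ring

theorem supNorm_pow_mul_wave_id (n : ℕ) :
    supNorm (fun x => (s * Complex.I) ^ n * wave id s x) = |s| ^ n := by
  simp [supNorm, norm_wave]

theorem supNorm_iteratedDerivWithin_wave_id (n : ℕ) :
    supNorm (iteratedDerivWithin n (wave id s) (Icc 0 1)) = |s| ^ n := by
  rw [← supNorm_pow_mul_wave_id n]
  simpa using supNorm_congr (iteratedDerivWithin_eqOn_of_hasDerivWithinAt
    uniqueDiffOn_Icc_zero_one (w := fun n x => (s * Complex.I) ^ n * wave id s x)
    (fun n x _ => hasDerivWithinAt_pow_mul_wave_id n) n)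

theorem IsNonAnalytic.memD_wave_id {M : ℕ → ℝ} (hna : IsNonAnalytic M) (hpos : ∀ n, 0 < M n) :
    MemD M (wave id s) :=
  ⟨contDiffOn_wave contDiffOn_id, by
    simpa only [supNorm_iteratedDerivWithin_wave_id]
      using hna.summable_pow_div hpos (abs_nonneg s)⟩

end Wave

theorem InducesEndomorphism.exists_wave_bound {M : ℕ → ℝ} {φ : ℝ → ℝ} (hpos : ∀ n, 0 < M n)
    (hna : IsNonAnalytic M) (hφ : MapsTo φ (Icc 0 1) (Icc 0 1)) (h : InducesEndomorphism M φ)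
    {r : ℝ} (hr : 1 < r) :
    ∃ A, 0 < A ∧ ∀ t, 0 < t → ∀ n, IsCentralIndex M t n → ∀ k, ∀ x ∈ Icc (0 : ℝ) 1,
      ‖iteratedDerivWithin k (wave φ (t / r)) (Icc 0 1) x‖ ≤ A * M k * (t ^ n / M n) := by
  obtain ⟨C, hC0, hC⟩ := h.exists_bound hpos hφ
  have hgeom : 0 < (1 - r⁻¹)⁻¹ := inv_pos.2 (sub_pos.2 (inv_lt_one_of_one_lt₀ hr))
  refine ⟨C * (1 - r⁻¹)⁻¹, by positivity, fun t ht n hn k x hx => ?_⟩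
  have hMk := hpos k
  calc ‖iteratedDerivWithin k (wave φ (t / r)) (Icc 0 1) x‖
      ≤ C * M k * ∑' j, (t / r) ^ j / M j := by
        simpa only [wave_id_comp, supNorm_iteratedDerivWithin_wave_id,
          abs_of_pos (div_pos ht (zero_lt_one.trans hr))]
          using hC (wave id (t / r)) (hna.memD_wave_id hpos) k x hx
    _ ≤ C * M k * ((1 - r⁻¹)⁻¹ * (t ^ n / M n)) := by
        gcongr
        exact hna.tsum_div_pow_le hpos hr ht.le hn
    _ = C * (1 - r⁻¹)⁻¹ * M k * (t ^ n / M n) := by ring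

theorem IsCentralIndex.norm_succ_mul_norm_le {E : Type*} [NormedAddCommGroup E] {M : ℕ → ℝ}
    {t : ℝ} {n : ℕ} (hn : IsCentralIndex M t n) (hpos : ∀ n, 0 < M n)
    (hmul : ∀ n m, M n * M m ≤ M (n + m)) (ht : 1 ≤ t) {v : ℕ → E} {A : ℝ} (hA : 0 ≤ A)
    (hv : ∀ k, ‖v k‖ ≤ A * M k * (t ^ n / M n))
    {k : ℕ} (hk : k < n) :
    ‖v (k + 1)‖ * ‖v k‖ ≤ A ^ 2 * (t ^ n / M n) ^ 4 * (t ^ 2) ^ (k + 1) := by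
  have ht0 : 0 ≤ t := by linarith
  set μ : ℝ := t ^ n / M n
  have hμ : 0 ≤ μ := div_nonneg (by positivity) (hpos n).le
  have hle : ∀ j ≤ n, ‖v j‖ ≤ A * (t ^ j * μ) * μ := fun j hj => (hv j).trans <| by
    gcongr
    exact hn.le_pow_mul ht0 hpos hmul hj
  calc ‖v (k + 1)‖ * ‖v k‖ ≤ A * (t ^ (k + 1) * μ) * μ * (A * (t ^ k * μ) * μ) := by
        gcongr
        exacts [hle _ hk, hle _ hk.le]
    _ ≤ A * (t ^ (k + 1) * μ) * μ * (A * (t ^ (k + 1) * μ) * μ) := by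
        gcongr
        exacts [k.le_succ]
    _ = A ^ 2 * μ ^ 4 * (t ^ 2) ^ (k + 1) := by ring

/-- The Gaussian parameter `B = 8 * t / d ^ 2` is large enough to beat the boundary terms by a
factor `exp (-6 * t)`, while the total drop `4 * B * n` of the growth ratio is `o(t ^ 2)`. -/
theorem IsCentralIndex.pow_le_of_le_norm_deriv {E : Type*} [NormedAddCommGroup E]
    [InnerProductSpace ℝ E] {M : ℕ → ℝ} {t : ℝ} {n : ℕ} (hn : IsCentralIndex M t n)
    (hpos : ∀ n, 0 < M n) (hmul : ∀ n m, M n * M m ≤ M (n + m)) (ht : 1 ≤ t)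
    {v : ℕ → ℝ → E} {A q α c d : ℝ} (hA : 0 ≤ A) (hq : 1 ≤ q) (hα : 0 ≤ α) (hd : 0 < d)
    (hv : ∀ k, ∀ x ∈ Icc (c - d) (c + d), HasDerivAt (v k) (v (k + 1) x) x)
    (h₀ : ∀ x ∈ Icc (c - d) (c + d), ‖v 0 x‖ = 1)
    (h₁ : ∀ x ∈ Icc (c - d) (c + d), α * t ≤ ‖v 1 x‖)
    (hbound : ∀ k, ∀ x ∈ Icc (c - d) (c + d), ‖v k x‖ ≤ A * M k * (t ^ n / M n))
    (hnt : n ≤ (α ^ 2 - q ^ 2) * d ^ 2 / 32 * t)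
    (hexp : 2 * α ^ 2 * A ^ 2 * t ^ 2 * (t ^ n / M n) ^ 4 ≤ 8 / d * t * Real.exp (6 * t)) :
    q ^ n ≤ A := by
  have ht0 : 0 < t := by linarith
  have hsq : ((q * t) ^ 2) ^ n ≤ (A * t ^ n) ^ 2 := by
    refine pow_le_sq_of_norm_derivs_le (B := 8 * t / d ^ 2) (R := (α * t) ^ 2) (by positivity) hd
      (sq_nonneg _) ?_ hv h₀ (fun x hx => pow_le_pow_left₀ (by positivity) (h₁ x hx) 2)
      (fun x hx => ?_) (fun k hk x hx => ?_) (P := A ^ 2 * (t ^ n / M n) ^ 4) (by positivity) ?_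
    · calc (q * t) ^ 2 + 4 * (8 * t / d ^ 2) * n
          ≤ (q * t) ^ 2 + 4 * (8 * t / d ^ 2) * ((α ^ 2 - q ^ 2) * d ^ 2 / 32 * t) := by gcongr
        _ = (α * t) ^ 2 := by field_simp; ring
    · have hMn := (hpos n).ne'
      exact (hbound n x hx).trans_eq (by field_simp)
    · refine (hn.norm_succ_mul_norm_le hpos hmul ht hA (v := fun k => v k x)
        (fun k => hbound k x hx) hk).trans ?_
      gcongr
      exact le_mul_of_one_le_left ht0.le hq
    · have hd' := hd.ne'
      calc 2 * (α * t) ^ 2 * (A ^ 2 * (t ^ n / M n) ^ 4)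
          = 2 * α ^ 2 * A ^ 2 * t ^ 2 * (t ^ n / M n) ^ 4 := by ring
        _ ≤ 8 / d * t * Real.exp (6 * t) := hexp
        _ = 8 * t / d ^ 2 * d * Real.exp (3 / 4 * (8 * t / d ^ 2 * d ^ 2)) := by
            rw [show 3 / 4 * (8 * t / d ^ 2 * d ^ 2) = 6 * t by field_simp; norm_num]
            field_simp
  refine le_of_mul_le_mul_right ?_ (pow_pos ht0 n)
  rw [← mul_pow]
  exact le_of_sq_le_sq (by rwa [← pow_mul, mul_comm n, pow_mul]) (by positivity)

theorem eventually_mul_sq_mul_exp_pow_le (K : ℝ) {L : ℝ} (hL : 0 < L) :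
    ∀ᶠ t : ℝ in atTop, K * t ^ 2 * Real.exp t ^ 4 ≤ L * t * Real.exp (6 * t) := by
  have hlin : ∀ᶠ t : ℝ in atTop, K * t ≤ L * Real.exp t := by
    have h := ((Real.isLittleO_pow_exp_atTop (n := 1)).const_mul_left K).bound hL
    filter_upwards [h] with t ht
    simpa using (le_abs_self _).trans ht
  filter_upwards [hlin, eventually_ge_atTop 0] with t ht ht0
  have hexp : Real.exp t ^ 4 * Real.exp t ≤ Real.exp (6 * t) := by
    rw [← pow_succ, ← Real.exp_nat_mul, Real.exp_le_exp]
    push_cast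
    linarith
  calc K * t ^ 2 * Real.exp t ^ 4 = K * t * (t * Real.exp t ^ 4) := by ring
    _ ≤ L * Real.exp t * (t * Real.exp t ^ 4) := by gcongr
    _ = L * t * (Real.exp t ^ 4 * Real.exp t) := by ring
    _ ≤ L * t * Real.exp (6 * t) := by gcongr

theorem IsNonAnalytic.exists_isCentralIndex_le_exp {M : ℕ → ℝ} (hna : IsNonAnalytic M)
    (hpos : ∀ n, 0 < M n) (h0 : M 0 ≤ 1) (N : ℕ) {ε K L : ℝ} (hε : 0 < ε) (hK : 0 ≤ K)
    (hL : 0 < L) :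
    ∃ t n, 1 ≤ t ∧ N < n ∧ IsCentralIndex M t n ∧ n ≤ ε * t ∧
      K * t ^ 2 * (t ^ n / M n) ^ 4 ≤ L * t * Real.exp (6 * t) := by
  obtain ⟨C, hC⟩ := hna.exists_pow_div_le_exp hpos
  obtain ⟨t, hNt, hεt, hexp, ht⟩ := ((eventually_lt_of_isCentralIndex hpos N).and
    ((hna.eventually_isCentralIndex_le_mul hpos h0 hε).and
    ((eventually_mul_sq_mul_exp_pow_le (K * C ^ 4) hL).and (eventually_ge_atTop 1)))).exists
  have ht0 : 0 < t := by linarith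
  obtain ⟨n, hn⟩ := hna.exists_isCentralIndex hpos ht0
  have hμ : 0 ≤ t ^ n / M n := div_nonneg (by positivity) (hpos n).le
  refine ⟨t, n, ht, hNt n hn, hn, hεt n hn, ?_⟩
  calc K * t ^ 2 * (t ^ n / M n) ^ 4 ≤ K * t ^ 2 * (C * Real.exp t) ^ 4 := by
        gcongr
        exact hC n t ht0.le
    _ = K * C ^ 4 * t ^ 2 * Real.exp t ^ 4 := by ring
    _ ≤ L * t * Real.exp (6 * t) := hexp

theorem exists_abs_derivWithin_lt {M : ℕ → ℝ} (hpos : ∀ n, 0 < M n)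
    (hmul : ∀ n m, M n * M m ≤ M (n + m)) (hna : IsNonAnalytic M) {φ : ℝ → ℝ}
    (hφ : ContDiffOn ℝ ∞ φ (Icc 0 1)) {a r A : ℝ} (hr : 0 < r) (har : r < a) (hA : 0 ≤ A)
    (hbound : ∀ t, 0 < t → ∀ n, IsCentralIndex M t n → ∀ k, ∀ x ∈ Icc (0 : ℝ) 1,
      ‖iteratedDerivWithin k (wave φ (t / r)) (Icc 0 1) x‖ ≤ A * M k * (t ^ n / M n))
    {c d : ℝ} (hd : 0 < d) (hI : Icc (c - d) (c + d) ⊆ Ioo 0 1) :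
    ∃ x ∈ Icc (c - d) (c + d), |derivWithin φ (Icc 0 1) x| < a := by
  by_contra! hlarge
  set α := a / r
  obtain ⟨q, hq, hqα⟩ := exists_between ((one_lt_div hr).2 har)
  obtain ⟨N, hN⟩ := pow_unbounded_of_one_lt A hq
  have hgap : 0 < α ^ 2 - q ^ 2 := sub_pos.2 (pow_lt_pow_left₀ hqα (by linarith) two_ne_zero)
  have h0 : M 0 ≤ 1 := by nlinarith [hmul 0 0, hpos 0]
  obtain ⟨t, n, ht, hNn, hn, hnt, hexp⟩ := hna.exists_isCentralIndex_le_exp hpos h0 N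
    (show 0 < (α ^ 2 - q ^ 2) * d ^ 2 / 32 by positivity)
    (show 0 ≤ 2 * α ^ 2 * A ^ 2 by positivity) (show 0 < 8 / d by positivity)
  have ht0 : 0 < t := by linarith
  have hsub : Icc (c - d) (c + d) ⊆ Icc 0 1 := hI.trans Ioo_subset_Icc_self
  have hqA : q ^ n ≤ A := by
    refine hn.pow_le_of_le_norm_deriv hpos hmul ht
      (v := fun k => iteratedDerivWithin k (wave φ (t / r)) (Icc 0 1)) hA hq.le
      (zero_le_one.trans (hq.trans hqα).le) hd (fun k x hx => ?_) (fun x _ => ?_)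
      (fun x hx => ?_) (fun k x hx => hbound t ht0 n hn k x (hsub hx)) hnt hexp
    · exact (hasDerivWithinAt_iteratedDerivWithin uniqueDiffOn_Icc_zero_one (contDiffOn_wave hφ) k
        (hsub hx)).hasDerivAt (Icc_mem_nhds (hI hx).1 (hI hx).2)
    · rw [iteratedDerivWithin_zero, norm_wave]
    · rw [iteratedDerivWithin_one, norm_derivWithin_wave (hφ.differentiableOn (by simp) x (hsub hx))
        (uniqueDiffOn_Icc_zero_one x (hsub hx)), abs_of_pos (div_pos ht0 hr)]
      calc α * t = t / r * a := by simp only [α]; ring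
        _ ≤ t / r * |derivWithin φ (Icc 0 1) x| :=
            mul_le_mul_of_nonneg_left (hlarge x hx) (by positivity)
  exact (hN.trans (pow_lt_pow_right₀ hq hNn)).not_ge hqA

theorem le_of_forall_exists_lt {g : ℝ → ℝ} {α β K : ℝ} (hαβ : α < β)
    (hg : ContinuousOn g (Icc α β))
    (h : ∀ a > K, ∀ c d, 0 < d → Icc (c - d) (c + d) ⊆ Ioo α β →
      ∃ x ∈ Icc (c - d) (c + d), g x < a) {x : ℝ} (hx : x ∈ Icc α β) : g x ≤ K := by
  rw [← closure_Ioo hαβ.ne] at hx hg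
  refine le_on_closure (fun y hy => ?_) hg continuousOn_const hx
  by_contra! hK
  obtain ⟨a, hKa, hay⟩ := exists_between hK
  have hcont : ContinuousAt g y := (hg y (subset_closure hy)).continuousAt
    (mem_of_superset (isOpen_Ioo.mem_nhds hy) subset_closure)
  obtain ⟨d, hd, hball⟩ := Metric.nhds_basis_closedBall.mem_iff.1
    (inter_mem (isOpen_Ioo.mem_nhds hy) (hcont.eventually_const_lt hay))
  rw [Real.closedBall_eq_Icc, subset_inter_iff] at hball
  obtain ⟨z, hz, hza⟩ := h a hKa y d hd hball.1
  exact lt_asymm hza (hball.2 hz)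

theorem theorem1p2_general (M : ℕ → ℝ) (hpos : ∀ n, 0 < M n)
    (hmul : ∀ n m, M n * M m ≤ M (n + m)) (hna : IsNonAnalytic M)
    (φ : ℝ → ℝ) (hφ : MapsTo φ (Icc 0 1) (Icc 0 1)) (hind : InducesEndomorphism M φ) :
    ContDiffOn ℝ ∞ φ (Icc 0 1) ∧ supNorm (derivWithin φ (Icc 0 1)) ≤ 1 := by
  have hsmooth : ContDiffOn ℝ ∞ φ (Icc 0 1) := hind.contDiffOn
  have hcont : ContinuousOn (fun x => |derivWithin φ (Icc 0 1) x|) (Icc 0 1) :=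
    (hsmooth.continuousOn_derivWithin uniqueDiffOn_Icc_zero_one (by simp)).abs
  refine ⟨hsmooth, ciSup_le fun x => ?_⟩
  refine le_of_forall_exists_lt zero_lt_one hcont (fun a ha c d hd hI => ?_) x.2
  obtain ⟨r, hr, hra⟩ := exists_between (show (1 : ℝ) < a from ha)
  obtain ⟨A, hA, hbound⟩ := hind.exists_wave_bound hpos hna hφ hr
  exact exists_abs_derivWithin_lt hpos hmul hna hsmooth (by linarith) hra hA.le hbound hd hI

theorem theorem1p2 (M : ℕ → ℝ) (hM : IsWeight M) (hna : IsNonAnalytic M)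
    (φ : ℝ → ℝ) (hφ : MapsTo φ (Icc 0 1) (Icc 0 1)) (hind : InducesEndomorphism M φ) :
    ContDiffOn ℝ ∞ φ (Icc 0 1) ∧ supNorm (derivWithin φ (Icc 0 1)) ≤ 1 :=
  theorem1p2_general M hM.pos hM.mul_le hna φ hφ hind
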